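/- **Setting.** Let $n<m$ and let $A\in\mathbb{R}^{n\times m}$ have orthonormal rows ($AA^T=I_n$) and satisfy the Unique Representation Property (every $n\times n$ submatrix of $A$ is invertible). Write $\|\cdot\|$ for the Euclidean norm, $\|A\|_2$ for the spectral norm, $\|s\|_0$ for the number of nonzero entries of $s$. For $n_0\le n$ let $$\gamma=\gamma_A(n_0)=\max_{|I|\le n_0}\ \max_{As=0,\ s\ne 0}\ \frac{\sum_{i\in I}s_i^2}{\sum_{i\notin I}s_i^2},$$ where $I\subseteq\{1,\dots,m\}$. Let $$f_\gamma(t)=\begin{cases}1-t^2/(1+\gamma), & |t|\le 1,\\ (|t|-\gamma-1)^2/(\gamma^2+\gamma), & 1\le|t|\le 1+\gamma,\\ 0, & |t|\ge 1+\gamma,\end{cases}\qquad F_\sigma(s)=\sum_{i=1}^m f_\gamma(s_i/\sigma)\quad(\sigma>0).$$ For $x\in\mathbb{R}^n$ let $\mathcal S_x=\{s\in\mathbb{R}^m : As=x\}$ and $\hat s=A^T(AA^T)^{-1}x$. Given positive numbers $\sigma_1,\dots,\sigma_J$, *asymptotic SL0* produces points $s_1,\dots,s_J$ as follows: $s_1=\hat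 s$, and for $2\le j\le J$ the point $s_j$ is the limit as $t\to\infty$ of the steepest ascent trajectory of $F_{\sigma_j}$ restricted to $\mathcal S_x$ started at $s_{j-1}$, i.e. of the solution $\alpha:[0,\infty)\to\mathbb{R}^m$ of $\alpha(0)=s_{j-1}$, $\dot\alpha(t)=P\,\nabla F_{\sigma_j}(\alpha(t))$, with $P$ the orthogonal projection onto the null space of $A$. **Theorem.** Let $\epsilon>0$, $x\in\mathbb{R}^n$, and let $s_0\in\mathbb{R}^m$ satisfy $\|As_0-x\|<\epsilon$ and $k:=\|s_0\|_0<n_0/(2+2\gamma)$. Choose a real $k'$ with $k<k'<n_0/(2+2\gamma)$, and put $$\sigma_1=\frac{\|\hat s\|}{\sqrt{k'(1+\gamma)}},\qquad c=\frac{2m}{2m+n_0/(2+2\gamma)-k'},\qquad \sigma_j=\sigma_1c^{\,j-1}.$$ Let $J\ge 1$ be the index of the smallest term of this sequence that is at least the noise threshold, that is, $$\sigma_J\ \ge\ \frac{2\sqrt m\,\|A\|_2\,\epsilon}{(1+\gamma)(k'-k)}\ >\ \sigma_{J+1}.$$ Then $c<1$; asymptotic SL0 with $\sigma_1,\dots,\sigma_J$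 is well defined (all the trajectories exist for all $t\ge 0$ and converge); for $2\le j\le J$ the point $s_j$ it produces is a global maximizer of $F_{\sigma_j}$ on $\mathcal S_x$; and the final point satisfies $$\|s_J-s_0\|\le C\epsilon,\qquad C=\Big(\frac{4m}{c(k'-k)\sqrt{\gamma+1}}+1\Big)\|A\|_2 .$$ -/

import Mathlib

open scoped Matrix

namespace SL0

noncomputable section

/-- The linear map `s ↦ A s` between Euclidean (`ℓ²`) spaces. -/
def mulMap {n m : ℕ} (A : Matrix (Fin n) (Fin m) ℝ) :
    EuclideanSpace ℝ (Fin m) →ₗ[ℝ] EuclideanSpace ℝ (Fin n) :=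
  Matrix.toEuclideanLin A

/-- The spectral norm `‖A‖₂`: the operator norm of `A` with respect to the `ℓ²` norms. -/
def specNorm {n m : ℕ} (A : Matrix (Fin n) (Fin m) ℝ) : ℝ :=
  ‖LinearMap.toContinuousLinearMap (mulMap A)‖

/-- Unique Representation Property: every `n × n` submatrix of the `n × m` matrix `A`
(`n` distinct columns) is invertible. -/
def URP {n m : ℕ} (A : Matrix (Fin n) (Fin m) ℝ) : Prop :=
  ∀ e : Fin n → Fin m, Function.Injective e → IsUnit (A.submatrix id e)

/-- The null space of `A`. -/
def nullSpace {n m : ℕ} (A : Matrix (Fin n) (Fin m) ℝ) :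
    Submodule ℝ (EuclideanSpace ℝ (Fin m)) :=
  LinearMap.ker (mulMap A)

/-- The set `S_x` of solutions of `A s = x`. -/
def solutionSet {n m : ℕ} (A : Matrix (Fin n) (Fin m) ℝ) (x : EuclideanSpace ℝ (Fin n)) :
    Set (EuclideanSpace ℝ (Fin m)) :=
  {s | mulMap A s = x}

/-- The number of nonzero entries `‖s‖₀`. -/
def l0 {m : ℕ} (s : EuclideanSpace ℝ (Fin m)) : ℕ :=
  hammingNorm (fun i => s i)

/-- `γ_A(n₀)`: the largest value of `‖π_I(s)‖² / ‖π_{Iᶜ}(s)‖²` over index sets `I` with at most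
`n₀` elements and nonzero `s` in the null space of `A`. (If `A` has the URP and `n₀ ≤ n`, the
denominators do not vanish and the set of values is bounded above.) -/
def gammaConst {n m : ℕ} (A : Matrix (Fin n) (Fin m) ℝ) (n₀ : ℕ) : ℝ :=
  sSup {r : ℝ | ∃ (I : Finset (Fin m)) (s : EuclideanSpace ℝ (Fin m)),
    I.card ≤ n₀ ∧ s ∈ nullSpace A ∧ s ≠ 0 ∧
    r = (∑ i ∈ I, s i ^ 2) / (∑ i ∈ Iᶜ, s i ^ 2)}

/-- The quadratic spline `f_γ` with knots `±1, ±(1 + γ)`. -/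
def spline (γ t : ℝ) : ℝ :=
  if |t| ≤ 1 then 1 - t ^ 2 / (1 + γ)
  else if |t| ≤ 1 + γ then (|t| - γ - 1) ^ 2 / (γ ^ 2 + γ)
  else 0

/-- The cost function `F_{γ,σ}(s) = ∑ i, f_γ(s_i / σ)`. -/
def cost {m : ℕ} (γ σ : ℝ) (s : EuclideanSpace ℝ (Fin m)) : ℝ :=
  ∑ i, spline γ (s i / σ)

/-- The Moore-Penrose solution `ŝ = Aᵀ (A Aᵀ)⁻¹ x` of `A s = x`. -/
def pinvSol {n m : ℕ} (A : Matrix (Fin n) (Fin m) ℝ) (x : EuclideanSpace ℝ (Fin n)) :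
    EuclideanSpace ℝ (Fin m) :=
  Matrix.toEuclideanLin (Aᵀ * (A * Aᵀ)⁻¹) x

/-- The gradient at `s` of the restriction of `F` to the affine space through `s` parallel to the
null space of `A`: the orthogonal projection of `∇F(s)` onto the null space. -/
def restrictedGradient {n m : ℕ} (A : Matrix (Fin n) (Fin m) ℝ)
    (F : EuclideanSpace ℝ (Fin m) → ℝ) (s : EuclideanSpace ℝ (Fin m)) :
    EuclideanSpace ℝ (Fin m) :=
  (nullSpace A).starProjection (gradient F s)

/-- `α : [0, ∞) → ℝᵐ` is the steepest ascent trajectory of `F` restricted to the solution set,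
started at `p`: `α(0) = p` and `α'(t) = ∇(F|_{S_x})(α(t))` for all `t ≥ 0`. -/
def IsSteepestAscent {n m : ℕ} (A : Matrix (Fin n) (Fin m) ℝ)
    (F : EuclideanSpace ℝ (Fin m) → ℝ) (p : EuclideanSpace ℝ (Fin m))
    (α : ℝ → EuclideanSpace ℝ (Fin m)) : Prop :=
  α 0 = p ∧
    ∀ t ∈ Set.Ici (0 : ℝ), HasDerivWithinAt α (restrictedGradient A F (α t)) (Set.Ici 0) t

/-- `s 1, …, s J` are the iterates of asymptotic SL0 with parameters `σ 1, …, σ J`: the first one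
is the minimum norm solution of `A s = x`, and for `2 ≤ j ≤ J` the iterate `s j` is the limit, as
time tends to infinity, of the steepest ascent trajectory of `F_{γ,σ_j}` on the solution set
started at `s (j - 1)`. -/
def IsAsymptoticRun {n m : ℕ} (A : Matrix (Fin n) (Fin m) ℝ) (x : EuclideanSpace ℝ (Fin n))
    (γ : ℝ) (σ : ℕ → ℝ) (J : ℕ) (s : ℕ → EuclideanSpace ℝ (Fin m)) : Prop :=
  s 1 = pinvSol A x ∧
    ∀ j, 2 ≤ j → j ≤ J → ∃ α : ℝ → EuclideanSpace ℝ (Fin m),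
      IsSteepestAscent A (cost γ (σ j)) (s (j - 1)) α ∧
      Filter.Tendsto α Filter.atTop (nhds (s j))

end

end SL0

/-! Let `ρ = n₀ / (2 + 2γ)`. A coordinate with `|s i| > σ` costs at least `1 / (1 + γ)`, so two
points of cost at least `m - ρ` have together at most `n₀` large coordinates; call their set `I`.
Off `I` the spline is exactly quadratic with leading coefficient `-1 / (1 + γ)`, and everywhere its
convexity is bounded by the coefficient `1 / (γ (1 + γ))`. If the points differ by a null vector,
the definition of `γ` makes the concave part win. This gives the gradient inequality of concave
functions (`cost_le_add_inner`) without the segment having to stay in the superlevel set, and, since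
entries off `I` are at most `2σ`, a bound on the distance (`norm_sub_sq_le`). Hence a maximizer
exists, and the gradient flow converges to one (`exists_tendsto_of_gradientFlow`).

The schedule keeps the run in this region. Shrinking `σ` by `c` costs at most `ρ - k'`, which takes
`m - k'` to `m - ρ`. Above the noise threshold the projection `p` of `s₀` to the solution set has
cost at least `m - k'`, so the next maximizer regains that level. At the end the distance bound is
applied to `s J` and `p`. -/

namespace SL0

noncomputable section

/-! ### The spline: smoothness and one-variable inequalities. -/

/-- The square of the positive part. -/
def posSq (t : ℝ) : ℝ := max t 0 ^ 2

theorem hasDerivAt_posSq (t : ℝ) : HasDerivAt posSq (2 * max t 0) t := by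
  rw [hasDerivAt_iff_isLittleO]
  have h : ∀ y, |posSq y - posSq t - (y - t) • (2 * max t 0)| ≤ |(y - t) ^ 2| := by
    intro y
    rw [abs_of_nonneg (sq_nonneg (y - t)), abs_le, posSq, posSq, smul_eq_mul]
    rcases max_cases t 0 with ⟨h1, h2⟩ | ⟨h1, h2⟩ <;>
      rcases max_cases y 0 with ⟨h3, h4⟩ | ⟨h3, h4⟩ <;> rw [h1, h3] <;>
      constructor <;> nlinarith
  refine (Asymptotics.IsBigO.of_bound 1 (Filter.Eventually.of_forall fun y => ?_)).trans_isLittleO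
    (g := fun y => (y - t) ^ 2) ?_
  · simpa using h y
  · have := Asymptotics.isLittleO_pow_sub_sub t (m := 2) (by norm_num)
    simpa using this

/-- The spline written without case distinctions. -/
theorem spline_eq {γ : ℝ} (hγ : 0 < γ) (t : ℝ) :
    spline γ t = 1 - t ^ 2 / (1 + γ) + (posSq (t - 1) + posSq (-t - 1)) / γ
      - (posSq (t - 1 - γ) + posSq (-t - 1 - γ)) / (γ * (1 + γ)) := by
  unfold spline posSq
  have h1 : γ ^ 2 + γ = γ * (1 + γ) := by ring
  have h2 : (1 + γ) ≠ 0 := by positivity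
  rw [h1]
  rcases abs_cases t with ⟨ha, hb⟩ | ⟨ha, hb⟩ <;> rw [ha]
  · rw [max_eq_right (by linarith : -t - 1 ≤ 0), max_eq_right (by linarith : -t - 1 - γ ≤ 0)]
    split_ifs with h3 h4
    · rw [max_eq_right (by linarith), max_eq_right (by linarith)]; simp
    · rw [max_eq_left (by linarith), max_eq_right (by linarith)]; field_simp; ring
    · rw [max_eq_left (by linarith), max_eq_left (by linarith)]; field_simp; ring
  · rw [max_eq_right (by linarith : t - 1 ≤ 0), max_eq_right (by linarith : t - 1 - γ ≤ 0)]
    split_ifs with h3 h4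
    · rw [max_eq_right (by linarith), max_eq_right (by linarith)]; simp
    · rw [max_eq_left (by linarith), max_eq_right (by linarith)]; field_simp; ring
    · rw [max_eq_left (by linarith), max_eq_left (by linarith)]; field_simp; ring

/-- The derivative of the spline. -/
def splineDeriv (γ t : ℝ) : ℝ :=
  -(2 * t) / (1 + γ) + (2 * max (t - 1) 0 - 2 * max (-t - 1) 0) / γ
    - (2 * max (t - 1 - γ) 0 - 2 * max (-t - 1 - γ) 0) / (γ * (1 + γ))

theorem hasDerivAt_spline {γ : ℝ} (hγ : 0 < γ) (t : ℝ) :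
    HasDerivAt (spline γ) (splineDeriv γ t) t := by
  rw [funext (spline_eq hγ)]
  have e1 : ∀ a : ℝ, HasDerivAt (fun t : ℝ => posSq (t - a)) (2 * max (t - a) 0) t := fun a => by
    simpa using! (hasDerivAt_posSq (t - a)).comp t ((hasDerivAt_id t).sub_const a)
  have e2 : ∀ a : ℝ, HasDerivAt (fun t : ℝ => posSq (-t - a)) (-(2 * max (-t - a) 0)) t :=
    fun a => by
    simpa using! (hasDerivAt_posSq (-t - a)).comp t ((hasDerivAt_id t).neg.sub_const a)
  have h := (((((hasDerivAt_id t).pow 2).div_const (1 + γ)).const_sub 1).add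
    (((e1 1).add (e2 1)).div_const γ)).sub (((e1 (1 + γ)).add (e2 (1 + γ))).div_const (γ * (1 + γ)))
  refine (h.congr_deriv ?_).congr_of_eventuallyEq (Filter.Eventually.of_forall fun y => ?_)
  · simp only [splineDeriv, sub_sub, id]; push_cast; ring
  · simp [sub_sub]

theorem splineDeriv_of_abs_le_one {γ : ℝ} (hγ : 0 < γ) {t : ℝ} (ht : |t| ≤ 1) :
    splineDeriv γ t = -(2 * t) / (1 + γ) := by
  obtain ⟨h1, h2⟩ := abs_le.1 ht
  rw [splineDeriv, max_eq_right (by linarith), max_eq_right (by linarith),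
    max_eq_right (by linarith), max_eq_right (by linarith)]
  simp

theorem spline_of_abs_le_one {γ t : ℝ} (ht : |t| ≤ 1) : spline γ t = 1 - t ^ 2 / (1 + γ) :=
  if_pos ht

/-- The slope is steepest at the knots `±1`. The bound controls both the speed of the flow and the
loss of cost under noise. -/
theorem abs_splineDeriv_le {γ : ℝ} (hγ : 0 < γ) (t : ℝ) : |splineDeriv γ t| ≤ 2 / (1 + γ) := by
  have hp : 0 < γ * (1 + γ) := by positivity
  have hp' : 0 < 1 + γ := by positivity
  have key : splineDeriv γ t = (-(2 * t) * γ +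
      (2 * max (t - 1) 0 - 2 * max (-t - 1) 0) * (1 + γ)
    - (2 * max (t - 1 - γ) 0 - 2 * max (-t - 1 - γ) 0)) / (γ * (1 + γ)) := by
    unfold splineDeriv; field_simp
  have h2 : 2 / (1 + γ) = (2 * γ) / (γ * (1 + γ)) := by field_simp
  rw [key, h2, abs_div, abs_of_pos hp]
  refine div_le_div_of_nonneg_right ?_ hp.le
  rw [abs_le]
  rcases max_cases (t - 1) 0 with ⟨a1, b1⟩ | ⟨a1, b1⟩ <;>
  rcases max_cases (-t - 1) 0 with ⟨a2, b2⟩ | ⟨a2, b2⟩ <;>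
  rcases max_cases (t - 1 - γ) 0 with ⟨a3, b3⟩ | ⟨a3, b3⟩ <;>
  rcases max_cases (-t - 1 - γ) 0 with ⟨a4, b4⟩ | ⟨a4, b4⟩ <;>
  rw [a1, a2, a3, a4] <;> constructor <;> nlinarith

theorem abs_spline_sub_le {γ : ℝ} (hγ : 0 < γ) (t u : ℝ) :
    |spline γ t - spline γ u| ≤ 2 / (1 + γ) * |t - u| := by
  have := Convex.norm_image_sub_le_of_norm_hasDerivWithin_le (s := Set.univ) (f := spline γ)
    (f' := splineDeriv γ) (C := 2 / (1 + γ)) (x := u) (y := t)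
    (fun x _ => (hasDerivAt_spline hγ x).hasDerivWithinAt) (fun x _ => abs_splineDeriv_le hγ x)
    convex_univ trivial trivial
  simpa using this

/-- The constant is crude, the sum over the pieces of the formula; only its finiteness matters, for
existence of trajectories. -/
theorem abs_splineDeriv_sub_le {γ : ℝ} (hγ : 0 < γ) (t u : ℝ) :
    |splineDeriv γ t - splineDeriv γ u| ≤ (2 / (1 + γ) + 4 / γ + 4 / (γ * (1 + γ))) * |t - u| := by
  have h1 : ∀ a : ℝ, |max (t - a) 0 - max (u - a) 0| ≤ |t - u| := fun a => by
    simpa using abs_max_sub_max_le_abs (t - a) (u - a) 0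
  have h2 : ∀ a : ℝ, |max (-t - a) 0 - max (-u - a) 0| ≤ |t - u| := fun a => by
    have := abs_max_sub_max_le_abs (-t - a) (-u - a) 0
    rwa [show -t - a - (-u - a) = -(t - u) by ring, abs_neg] at this
  have hp : 0 < γ * (1 + γ) := by positivity
  have hp' : 0 < 1 + γ := by positivity
  have key : splineDeriv γ t - splineDeriv γ u = -(2 / (1 + γ)) * (t - u)
    + 2 / γ * (max (t - 1) 0 - max (u - 1) 0) - 2 / γ * (max (-t - 1) 0 - max (-u - 1) 0)
    - 2 / (γ * (1 + γ)) * (max (t - (1 + γ)) 0 - max (u - (1 + γ)) 0)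
    + 2 / (γ * (1 + γ)) * (max (-t - (1 + γ)) 0 - max (-u - (1 + γ)) 0) := by
    unfold splineDeriv; simp only [sub_sub]; field_simp; ring
  have b : ∀ C x : ℝ, 0 ≤ C → |x| ≤ |t - u| → |C * x| ≤ C * |t - u| := fun C x hC hx => by
    rw [abs_mul, abs_of_nonneg hC]; gcongr
  have b0 := b (2 / (1 + γ)) _ (by positivity) le_rfl
  have b1 := b (2 / γ) _ (by positivity) (h1 1)
  have b2 := b (2 / γ) _ (by positivity) (h2 1)
  have b3 := b (2 / (γ * (1 + γ))) _ (by positivity) (h1 (1 + γ))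
  have b4 := b (2 / (γ * (1 + γ))) _ (by positivity) (h2 (1 + γ))
  have e4 : 4 / γ = 2 / γ + 2 / γ := by ring
  have e5 : 4 / (γ * (1 + γ)) = 2 / (γ * (1 + γ)) + 2 / (γ * (1 + γ)) := by ring
  rw [key, e4, e5]
  rw [abs_le] at b0 b1 b2 b3 b4 ⊢
  constructor <;> linarith [b0.1, b0.2, b1.1, b1.2, b2.1, b2.2, b3.1, b3.2, b4.1, b4.2]

theorem posSq_gradient_le (t u : ℝ) : posSq t + 2 * max t 0 * (u - t) ≤ posSq u := by
  unfold posSq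
  rcases max_cases t 0 with ⟨h1, h2⟩ | ⟨h1, h2⟩ <;>
    rcases max_cases u 0 with ⟨h3, h4⟩ | ⟨h3, h4⟩ <;> rw [h1, h3] <;>
    nlinarith [sq_nonneg (u - t)]

/-- This is convexity of the Huber function, equal to `t ^ 2` on `[-1, 1]` and to `2 |t| - 1`
outside. -/
theorem huber_gradient_le (t u : ℝ) :
    t ^ 2 - posSq (t - 1) - posSq (-t - 1)
      + (2 * t - 2 * max (t - 1) 0 + 2 * max (-t - 1) 0) * (u - t)
    ≤ u ^ 2 - posSq (u - 1) - posSq (-u - 1) := by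
  unfold posSq
  rcases max_cases (t - 1) 0 with ⟨a1, b1⟩ | ⟨a1, b1⟩ <;>
  rcases max_cases (-t - 1) 0 with ⟨a2, b2⟩ | ⟨a2, b2⟩ <;>
  rcases max_cases (u - 1) 0 with ⟨a3, b3⟩ | ⟨a3, b3⟩ <;>
  rcases max_cases (-u - 1) 0 with ⟨a4, b4⟩ | ⟨a4, b4⟩ <;>
  rw [a1, a2, a3, a4] <;> nlinarith [sq_nonneg (u - t)]

/-- One-sided quadratic bound: the second derivative of the spline is at most
`2 / (γ (1 + γ))`. -/
theorem spline_le {γ : ℝ} (hγ : 0 < γ) (t u : ℝ) :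
    spline γ u ≤ spline γ t + splineDeriv γ t * (u - t) + (u - t) ^ 2 / (γ * (1 + γ)) := by
  have h1 := huber_gradient_le t u
  have h2 := posSq_gradient_le (t - 1 - γ) (u - 1 - γ)
  have h3 := posSq_gradient_le (-t - 1 - γ) (-u - 1 - γ)
  have hp : 0 < γ * (1 + γ) := by positivity
  -- Up to a constant, `t ^ 2 / (γ (1 + γ)) - spline γ t` is a positive combination of the Huber
  -- function and two shifted `posSq`, all convex.
  have e : spline γ t + splineDeriv γ t * (u - t) + (u - t) ^ 2 / (γ * (1 + γ)) - spline γ u =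
      ((1 + γ) * ((u ^ 2 - posSq (u - 1) - posSq (-u - 1)) - (t ^ 2 - posSq (t - 1) - posSq (-t - 1)
      + (2 * t - 2 * max (t - 1) 0 + 2 * max (-t - 1) 0) * (u - t)))
      + (posSq (u - 1 - γ) - (posSq (t - 1 - γ) + 2 * max (t - 1 - γ) 0 * (u - 1 - γ - (t - 1 - γ))))
      + (posSq (-u - 1 - γ) -
        (posSq (-t - 1 - γ) + 2 * max (-t - 1 - γ) 0 * (-u - 1 - γ - (-t - 1 - γ)))))
      / (γ * (1 + γ)) := by
    rw [spline_eq hγ, spline_eq hγ, splineDeriv]; field_simp; ring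
  have : 0 ≤ spline γ t + splineDeriv γ t * (u - t) + (u - t) ^ 2 / (γ * (1 + γ)) - spline γ u := by
    rw [e]
    refine div_nonneg ?_ hp.le
    have : 0 ≤ 1 + γ := by positivity
    have := mul_nonneg this (sub_nonneg.2 h1)
    linarith
  linarith

theorem spline_eq_of_abs_le_one {γ : ℝ} (hγ : 0 < γ) {t u : ℝ} (ht : |t| ≤ 1) (hu : |u| ≤ 1) :
    spline γ u = spline γ t + splineDeriv γ t * (u - t) - (u - t) ^ 2 / (1 + γ) := by
  rw [spline_of_abs_le_one ht, spline_of_abs_le_one hu, splineDeriv_of_abs_le_one hγ ht]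
  ring

theorem spline_zero (γ : ℝ) : spline γ 0 = 1 := by simp [spline]

theorem spline_nonneg {γ : ℝ} (hγ : 0 < γ) (t : ℝ) : 0 ≤ spline γ t := by
  unfold spline
  split_ifs with h1 h2
  · have : t ^ 2 ≤ 1 := (sq_le_one_iff_abs_le_one t).2 h1
    rw [sub_nonneg, div_le_one (by positivity)]; linarith
  · positivity
  · exact le_rfl

theorem spline_le_one {γ : ℝ} (hγ : 0 < γ) (t : ℝ) : spline γ t ≤ 1 := by
  unfold spline
  split_ifs with h1 h2
  · have : 0 ≤ t ^ 2 / (1 + γ) := by positivity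
    linarith
  · rw [div_le_one (by positivity)]; nlinarith
  · exact zero_le_one

theorem spline_le_of_one_lt {γ : ℝ} (hγ : 0 < γ) {t : ℝ} (ht : 1 < |t|) :
    spline γ t ≤ 1 - 1 / (1 + γ) := by
  have e : 1 - 1 / (1 + γ) = γ ^ 2 / (γ ^ 2 + γ) := by field_simp; ring
  rw [e]
  unfold spline
  split_ifs with h1 h2
  · linarith
  · gcongr 1; nlinarith
  · positivity

/-- Between the knots the difference is `(|t| - 1) ^ 2 / γ`. The bound turns a norm into a lower
bound for the cost. -/
theorem one_sub_sq_le_spline {γ : ℝ} (hγ : 0 < γ) (t : ℝ) :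
    1 - t ^ 2 / (1 + γ) ≤ spline γ t := by
  unfold spline
  rw [← sq_abs]
  split_ifs with h1 h2
  · exact le_rfl
  · rw [show γ ^ 2 + γ = γ * (1 + γ) by ring, le_div_iff₀ (by positivity)]
    have : (1 - |t| ^ 2 / (1 + γ)) * (γ * (1 + γ)) = γ * (1 + γ) - γ * |t| ^ 2 := by field_simp
    rw [this]; nlinarith [sq_nonneg ((1 + γ) * (|t| - 1))]
  · rw [sub_nonpos, one_le_div (by positivity)]; nlinarith

/-- Stability of the spline under dilations of its argument. -/
theorem spline_sub_spline_div_le {γ : ℝ} (hγ : 0 < γ) {c : ℝ} (hc : 0 < c) (hc1 : c ≤ 1) (t : ℝ) :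
    spline γ t - spline γ (t / c) ≤ 2 * (1 / c - 1) := by
  have hc' : 1 ≤ 1 / c := by rw [le_div_iff₀ hc]; linarith
  -- On the support the displacement is at most `(1 + γ) (1 / c - 1)`, and `1 + γ` cancels against
  -- the slope bound.
  by_cases h : |t| ≤ 1 + γ
  · have h1 := (le_abs_self _).trans (abs_spline_sub_le hγ t (t / c))
    have e : |t - t / c| = |t| * (1 / c - 1) := by
      rw [show t - t / c = -(t * (1 / c - 1)) by ring, abs_neg, abs_mul,
        abs_of_nonneg (sub_nonneg.2 hc')]
    rw [e] at h1
    have h2 : 2 / (1 + γ) * (|t| * (1 / c - 1)) ≤ 2 / (1 + γ) * ((1 + γ) * (1 / c - 1)) := by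
      gcongr
    have h3 : 2 / (1 + γ) * ((1 + γ) * (1 / c - 1)) = 2 * (1 / c - 1) := by field_simp
    linarith
  · have : spline γ t = 0 := by
      unfold spline; rw [if_neg (by linarith), if_neg h]
    have := spline_nonneg hγ (t / c)
    linarith

/-! ### Existence and convergence of gradient trajectories. -/

section Flow

open Set Filter Topology
open scoped NNReal

/-- A bounded Lipschitz vector field has integral curves defined on `[0, ∞)`. -/
theorem exists_integralCurve_Ici {E : Type*} [NormedAddCommGroup E] [NormedSpace ℝ E]
    [CompleteSpace E] {v : E → E} {K L : ℝ≥0} (hv : LipschitzWith K v) (hL : ∀ x, ‖v x‖ ≤ L)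
    (p : E) :
    ∃ α : ℝ → E, α 0 = p ∧ ∀ t ∈ Ici (0 : ℝ), HasDerivWithinAt α (v (α t)) (Ici 0) t := by
  -- At speed at most `L` the curve stays in the ball of radius `L * N` up to time `N`, so
  -- Picard–Lindelöf covers all of `[0, N]`.
  have hex : ∀ N : ℕ, ∃ α : ℝ → E, α 0 = p ∧
      ∀ t ∈ Icc (0 : ℝ) N, HasDerivWithinAt α (v (α t)) (Icc 0 N) t := by
    intro N
    have h0 : (0 : ℝ) ∈ Icc (0 : ℝ) N := ⟨le_rfl, N.cast_nonneg⟩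
    have hpl : IsPicardLindelof (fun _ : ℝ => v) (⟨0, h0⟩ : Icc (0 : ℝ) N) p (L * N) 0 L K :=
      IsPicardLindelof.of_time_independent (fun x _ => hL x) hv.lipschitzOnWith (by simp)
    exact hpl.exists_eq_forall_mem_Icc_hasDerivWithinAt₀
  choose a ha0 ha using hex
  have hcont : ∀ N, ContinuousOn (a N) (Icc 0 N) := fun N t ht => (ha N t ht).continuousWithinAt
  have huniq : ∀ M N : ℕ, M ≤ N → EqOn (a M) (a N) (Icc 0 M) := by
    intro M N hMN
    have hMN' : (M : ℝ) ≤ N := by exact_mod_cast hMN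
    refine ODE_solution_unique (v := fun _ => v) (fun _ => hv) (hcont M)
      (fun t ht => ?_) ((hcont N).mono (Icc_subset_Icc_right hMN')) (fun t ht => ?_)
      (by rw [ha0, ha0])
    · exact ((ha M t ⟨ht.1, ht.2.le⟩).mono_of_mem_nhdsWithin
        (Icc_mem_nhdsGE_of_mem ht))
    · exact ((ha N t ⟨ht.1, ht.2.le.trans hMN'⟩).mono_of_mem_nhdsWithin
        (Icc_mem_nhdsGE_of_mem ⟨ht.1, ht.2.trans_le hMN'⟩))
  have heq : ∀ (N : ℕ) (t : ℝ), t ∈ Icc (0 : ℝ) N → a ⌈t⌉₊ t = a N t := by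
    intro N t ht
    exact huniq _ _ (Nat.ceil_le.2 ht.2) ⟨ht.1, Nat.le_ceil t⟩
  refine ⟨fun t => a ⌈t⌉₊ t, by simp [ha0], fun t ht => ?_⟩
  obtain ⟨N, hN⟩ := exists_nat_gt t
  have hmem : t ∈ Icc (0 : ℝ) N := ⟨ht, hN.le⟩
  have hd := ha N t hmem
  have hd' : HasDerivWithinAt (fun t => a ⌈t⌉₊ t) (v (a N t)) (Icc 0 N) t :=
    hd.congr (fun y hy => heq N y hy) (heq N t hmem)
  change HasDerivWithinAt _ (v (a ⌈t⌉₊ t)) _ _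
  rw [heq N t hmem]
  refine hd'.mono_of_mem_nhdsWithin ?_
  rw [← Ici_inter_Iic]
  exact inter_mem_nhdsWithin _ (Iic_mem_nhds hN)

variable {E : Type*} [NormedAddCommGroup E] [InnerProductSpace ℝ E] [FiniteDimensional ℝ E]

/-- Convergence of the projected gradient flow of a function which satisfies the gradient
inequality of concave functions on the superlevel set of the starting point. -/
theorem exists_tendsto_of_gradientFlow (W : Submodule ℝ E) {F : E → ℝ} {g : E → E}
    (hF : ∀ s, HasGradientAt F (g s) s) {α : ℝ → E}
    (hα : ∀ t ∈ Ici (0 : ℝ), HasDerivWithinAt α (W.starProjection (g (α t))) (Ici 0) t)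
    (hconc : ∀ s s', s - α 0 ∈ W → s' - α 0 ∈ W → F (α 0) ≤ F s → F (α 0) ≤ F s' →
      F s' ≤ F s + inner ℝ (g s) (s' - s))
    {p : E} (hpW : p - α 0 ∈ W) (hp : ∀ s, s - α 0 ∈ W → F s ≤ F p) :
    ∃ q, Tendsto α atTop (𝓝 q) ∧ q - α 0 ∈ W ∧ ∀ s, s - α 0 ∈ W → F s ≤ F q := by
  have hcont : ContinuousOn α (Ici 0) := fun t ht => (hα t ht).continuousWithinAt
  have hFc : Continuous F := continuous_iff_continuousAt.2 fun s => (hF s).continuousAt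
  -- the trajectory stays in the affine space
  have hW : ∀ t ∈ Ici (0 : ℝ), α t - α 0 ∈ W := by
    intro t ht
    -- `Q` kills the velocity, so `Q ∘ α` is constant.
    let Q : E →L[ℝ] E := ContinuousLinearMap.id ℝ E - W.starProjection
    have hQ : ∀ w ∈ W, Q w = 0 := fun w hw => by
      simp [Q, Submodule.starProjection_eq_self_iff.2 hw]
    have hc := constant_of_has_deriv_right_zero (f := fun u => Q (α u)) (a := 0) (b := t)
      (Q.continuous.comp_continuousOn (hcont.mono Icc_subset_Ici_self)) (fun u hu => by
        have h1 := (Q.hasFDerivAt.comp_hasDerivWithinAt u (hα u hu.1)).mono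
          (Ici_subset_Ici.2 hu.1)
        rwa [hQ _ (W.starProjection_apply_mem _)] at h1) t ⟨ht, le_rfl⟩
    have : Q (α t - α 0) = 0 := by rw [map_sub, sub_eq_zero]; exact hc
    rw [← Submodule.starProjection_eq_self_iff]
    exact (sub_eq_zero.1 this).symm
  have hFα : ∀ t ∈ Ici (0 : ℝ), HasDerivWithinAt (fun t => F (α t))
      (inner ℝ (g (α t)) (W.starProjection (g (α t)))) (Ici 0) t := by
    intro t ht
    simpa using! (hF (α t)).hasFDerivAt.comp_hasDerivWithinAt t (hα t ht)
  have hnn : ∀ x, 0 ≤ inner ℝ (g x) (W.starProjection (g x)) := fun x => by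
    rw [real_inner_comm]; exact W.re_inner_starProjection_nonneg (𝕜 := ℝ) (g x)
  have hmono : MonotoneOn (fun t => F (α t)) (Ici 0) :=
    monotoneOn_of_hasDerivWithinAt_nonneg (convex_Ici 0)
      (fun t ht => (hFα t ht).continuousWithinAt)
      (fun t ht => (hFα t (interior_subset ht)).mono interior_subset) (fun t _ => hnn _)
  have hge : ∀ t ∈ Ici (0 : ℝ), F (α 0) ≤ F (α t) := fun t ht => hmono self_mem_Ici ht ht
  -- distance to a maximizer
  have hD : ∀ q, q - α 0 ∈ W → ∀ t ∈ Ici (0 : ℝ), HasDerivWithinAt (fun t => ‖α t - q‖ ^ 2)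
      (2 * inner ℝ (α t - q) (g (α t))) (Ici 0) t := by
    intro q hq t ht
    have h1 := ((hα t ht).sub_const q).norm_sq
    have h2 : α t - q ∈ W := by simpa using W.sub_mem (hW t ht) hq
    rwa [← Submodule.inner_starProjection_left_eq_right,
      Submodule.starProjection_eq_self_iff.2 h2] at h1
  have hDle : ∀ q, q - α 0 ∈ W → (∀ s, s - α 0 ∈ W → F s ≤ F q) → ∀ t ∈ Ici (0 : ℝ),
      inner ℝ (α t - q) (g (α t)) ≤ F (α t) - F q := by
    intro q hq hmax t ht
    have h1 := hconc (α t) q (hW t ht) hq (hge t ht) (hmax _ (by simp))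
    rw [real_inner_comm, ← neg_sub q (α t), inner_neg_right]
    linarith
  -- Stated for every maximizer because it is used twice: for `p`, to confine the trajectory, and
  -- for a limit point `q`, to pass from a subsequence to the whole trajectory.
  have hanti : ∀ q, q - α 0 ∈ W → (∀ s, s - α 0 ∈ W → F s ≤ F q) →
      AntitoneOn (fun t => ‖α t - q‖ ^ 2) (Ici 0) := by
    intro q hq hmax
    refine antitoneOn_of_hasDerivWithinAt_nonpos (convex_Ici 0)
      (fun t ht => (hD q hq t ht).continuousWithinAt)
      (fun t ht => (hD q hq t (interior_subset ht)).mono interior_subset) (fun t ht => ?_)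
    have := hDle q hq hmax t (interior_subset ht)
    have := hmax _ (hW t (interior_subset ht))
    linarith
  -- the Lyapunov function
  have hlyap : AntitoneOn (fun t => ‖α t - p‖ ^ 2 + 2 * (t * (F p - F (α t)))) (Ici 0) := by
    have hd : ∀ t ∈ Ici (0 : ℝ), HasDerivWithinAt
        (fun t => ‖α t - p‖ ^ 2 + 2 * (t * (F p - F (α t))))
        (2 * inner ℝ (α t - p) (g (α t)) + 2 * (1 * (F p - F (α t)) +
          t * (-(inner ℝ (g (α t)) (W.starProjection (g (α t))))))) (Ici 0) t := fun t ht =>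
      (hD p hpW t ht).add (((hasDerivWithinAt_id t _).mul ((hFα t ht).const_sub (F p))).const_mul 2)
    refine antitoneOn_of_hasDerivWithinAt_nonpos (convex_Ici 0)
      (fun t ht => (hd t ht).continuousWithinAt)
      (fun t ht => (hd t (interior_subset ht)).mono interior_subset) (fun t ht => ?_)
    have h1 := hDle p hpW hp t (interior_subset ht)
    have h2 : 0 ≤ t * inner ℝ (g (α t)) (W.starProjection (g (α t))) :=
      mul_nonneg (interior_subset ht) (hnn _)
    linarith
  -- Comparing the Lyapunov function at `0` and `t` gives `F p - F (α t) ≤ ‖α 0 - p‖ ^ 2 / (2 t)`.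
  have hlim : Tendsto (fun t => F (α t)) atTop (𝓝 (F p)) := by
    have h1 : Tendsto (fun t : ℝ => F p - ‖α 0 - p‖ ^ 2 / 2 / t) atTop (𝓝 (F p - 0)) :=
      tendsto_const_nhds.sub (tendsto_const_nhds.div_atTop tendsto_id)
    rw [sub_zero] at h1
    refine tendsto_of_tendsto_of_tendsto_of_le_of_le' h1 tendsto_const_nhds ?_ ?_
    · filter_upwards [eventually_gt_atTop 0] with t ht
      have h2 := hlyap self_mem_Ici (mem_Ici.2 ht.le) ht.le
      simp only [zero_mul, mul_zero, add_zero] at h2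
      have h3 : F p - F (α t) ≤ ‖α 0 - p‖ ^ 2 / 2 / t := by
        rw [le_div_iff₀ ht]
        have : 0 ≤ ‖α t - p‖ ^ 2 := by positivity
        linarith
      linarith
    · filter_upwards [eventually_ge_atTop 0] with t ht using hp _ (hW t ht)
  -- a limit point
  have hball : ∀ N : ℕ, α N ∈ Metric.closedBall p ‖α 0 - p‖ := by
    intro N
    rw [mem_closedBall_iff_norm]
    exact (pow_le_pow_iff_left₀ (norm_nonneg _) (norm_nonneg _) two_ne_zero).1
      (hanti p hpW hp self_mem_Ici (mem_Ici.2 N.cast_nonneg) N.cast_nonneg)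
  obtain ⟨q, -, φ, hφ, hq⟩ := (isCompact_closedBall p ‖α 0 - p‖).tendsto_subseq hball
  have hφt : Tendsto (fun k => ((φ k : ℕ) : ℝ)) atTop atTop :=
    tendsto_natCast_atTop_atTop.comp hφ.tendsto_atTop
  have hqW : q - α 0 ∈ W := (Submodule.closed_of_finiteDimensional W).mem_of_tendsto
    (hq.sub_const (α 0)) (Eventually.of_forall fun k => hW _ (mem_Ici.2 (Nat.cast_nonneg _)))
  have hFq : F q = F p := tendsto_nhds_unique ((hFc.tendsto q).comp hq) (hlim.comp hφt)
  have hqmax : ∀ s, s - α 0 ∈ W → F s ≤ F q := fun s hs => hFq ▸ hp s hs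
  refine ⟨q, ?_, hqW, hqmax⟩
  rw [Metric.tendsto_atTop]
  intro ε hε
  obtain ⟨k, hk⟩ := (Metric.tendsto_atTop.1 hq ε hε)
  refine ⟨φ k, fun t ht => ?_⟩
  have h0 : (0 : ℝ) ≤ φ k := Nat.cast_nonneg _
  have h1 : ‖α t - q‖ ≤ ‖α (φ k) - q‖ :=
    (pow_le_pow_iff_left₀ (norm_nonneg _) (norm_nonneg _) two_ne_zero).1
      (hanti q hqW hqmax (mem_Ici.2 h0) (mem_Ici.2 (h0.trans ht)) ht)
  have h2 := hk k le_rfl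
  rw [dist_eq_norm] at h2 ⊢
  exact h1.trans_lt h2

end Flow

/-! ### The null space under the URP and the constant `γ`. -/

section NullSpace

variable {n m : ℕ} {A : Matrix (Fin n) (Fin m) ℝ}

theorem mem_nullSpace {v : EuclideanSpace ℝ (Fin m)} :
    v ∈ nullSpace A ↔ A *ᵥ v.ofLp = 0 := by
  rw [nullSpace, LinearMap.mem_ker, mulMap, Matrix.toLpLin_apply, WithLp.toLp_eq_zero]

/-- Under the URP a null vector supported on at most `n` coordinates vanishes. -/
theorem eq_zero_of_mem_nullSpace (hURP : URP A) (hnm : n ≤ m) {v : EuclideanSpace ℝ (Fin m)}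
    (hv : v ∈ nullSpace A) {I : Finset (Fin m)} (hI : I.card ≤ n) (hvI : ∀ i ∉ I, v i = 0) :
    v = 0 := by
  obtain ⟨T, hIT, hT⟩ := Finset.exists_superset_card_eq hI (by simpa using hnm)
  let e : Fin n → Fin m := T.orderEmbOfFin hT
  have he : Function.Injective e := (T.orderEmbOfFin hT).injective
  have hrange : ∀ i, i ∈ T ↔ ∃ j, e j = i := fun i => by
    have := Set.ext_iff.1 (T.range_orderEmbOfFin hT) i
    exact this.symm
  have hsub : A.submatrix id e *ᵥ (fun j => v (e j)) = 0 := by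
    ext a
    have h0 := congrFun (mem_nullSpace.1 hv) a
    simp only [Matrix.mulVec, dotProduct, Matrix.submatrix_apply, id, Pi.zero_apply] at h0 ⊢
    rw [← h0, ← Finset.sum_subset (Finset.subset_univ T)]
    · rw [← Finset.sum_coe_sort T]
      exact Fintype.sum_equiv (T.orderIsoOfFin hT).toEquiv _ _ (fun j => rfl)
    · intro i _ hi
      rw [hvI i (fun h => hi (hIT h)), mul_zero]
  have hz := Matrix.mulVec_injective_of_isUnit (hURP e he) (hsub.trans (Matrix.mulVec_zero _).symm)
  ext i
  by_cases hi : i ∈ T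
  · obtain ⟨j, rfl⟩ := (hrange i).1 hi
    exact congrFun hz j
  · exact hvI i (fun h => hi (hIT h))

theorem norm_sq_eq_add (v : EuclideanSpace ℝ (Fin m)) (I : Finset (Fin m)) :
    ‖v‖ ^ 2 = ∑ i ∈ I, v i ^ 2 + ∑ i ∈ Iᶜ, v i ^ 2 := by
  rw [Finset.sum_add_sum_compl, EuclideanSpace.real_norm_sq_eq]

theorem sum_compl_pos (hURP : URP A) (hnm : n ≤ m) {v : EuclideanSpace ℝ (Fin m)}
    (hv : v ∈ nullSpace A) (hv0 : v ≠ 0) {I : Finset (Fin m)} (hI : I.card ≤ n) :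
    0 < ∑ i ∈ Iᶜ, v i ^ 2 := by
  refine lt_of_le_of_ne (Finset.sum_nonneg fun i _ => sq_nonneg _) fun h => hv0 ?_
  refine eq_zero_of_mem_nullSpace hURP hnm hv hI fun i hi => ?_
  have := (Finset.sum_eq_zero_iff_of_nonneg fun i _ => sq_nonneg (v i)).1 h.symm i
    (Finset.mem_compl.2 hi)
  simpa using this

/-- The restriction of null vectors to the complement of a small index set is bounded below. -/
theorem exists_norm_sq_le (hURP : URP A) (hnm : n ≤ m) {I : Finset (Fin m)} (hI : I.card ≤ n) :
    ∃ K : ℝ, 0 ≤ K ∧ ∀ v ∈ nullSpace A, ‖v‖ ^ 2 ≤ K * ∑ i ∈ Iᶜ, v i ^ 2 := by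
  -- `f` erases the coordinates in `I`. It is injective by the URP, hence bounded below in finite
  -- dimension.
  let f : nullSpace A →ₗ[ℝ] EuclideanSpace ℝ (Fin m) :=
    { toFun := fun v => WithLp.toLp 2 fun i => if i ∈ I then 0 else v.1 i
      map_add' := fun v w => by ext i; by_cases h : i ∈ I <;> simp [h]
      map_smul' := fun a v => by ext i; by_cases h : i ∈ I <;> simp [h] }
  have hf : LinearMap.ker f = ⊥ := by
    rw [LinearMap.ker_eq_bot']
    intro v hv
    refine Subtype.ext (eq_zero_of_mem_nullSpace hURP hnm v.2 hI fun i hi => ?_)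
    have := congrArg (fun w : EuclideanSpace ℝ (Fin m) => w i) hv
    simpa [f, hi] using this
  obtain ⟨K, -, hK⟩ := f.exists_antilipschitzWith hf
  refine ⟨K ^ 2, by positivity, fun v hv => ?_⟩
  have h1 : ‖v‖ ≤ K * ‖f ⟨v, hv⟩‖ := by
    simpa [dist_eq_norm] using hK.le_mul_dist (⟨v, hv⟩ : nullSpace A) 0
  have h2 : ‖f ⟨v, hv⟩‖ ^ 2 = ∑ i ∈ Iᶜ, v i ^ 2 := by
    rw [norm_sq_eq_add _ I, Finset.sum_eq_zero, zero_add]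
    · refine Finset.sum_congr rfl fun i hi => ?_
      simp [f, Finset.mem_compl.1 hi]
    · intro i hi; simp [f, hi]
  rw [← h2, ← mul_pow]
  exact pow_le_pow_left₀ (norm_nonneg _) h1 2

/-- Real `sSup` is `0` on a set unbounded above, so boundedness is what makes `gammaConst` an upper
bound of the ratios. -/
theorem bddAbove_gammaConst (hURP : URP A) (hnm : n ≤ m) {n₀ : ℕ} (hn₀ : n₀ ≤ n) :
    BddAbove {r : ℝ | ∃ (I : Finset (Fin m)) (s : EuclideanSpace ℝ (Fin m)),
      I.card ≤ n₀ ∧ s ∈ nullSpace A ∧ s ≠ 0 ∧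
      r = (∑ i ∈ I, s i ^ 2) / (∑ i ∈ Iᶜ, s i ^ 2)} := by
  have h : ∀ I : Finset (Fin m), ∃ K : ℝ, 0 ≤ K ∧
      (I.card ≤ n → ∀ v ∈ nullSpace A, ‖v‖ ^ 2 ≤ K * ∑ i ∈ Iᶜ, v i ^ 2) := fun I => by
    by_cases hI : I.card ≤ n
    · obtain ⟨K, hK, h⟩ := exists_norm_sq_le hURP hnm hI
      exact ⟨K, hK, fun _ => h⟩
    · exact ⟨0, le_rfl, fun h => absurd h hI⟩
  choose K hK0 hK using h
  refine ⟨∑ I, K I, ?_⟩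
  rintro r ⟨I, s, hI, hs, hs0, rfl⟩
  have hpos := sum_compl_pos hURP hnm hs hs0 (hI.trans hn₀)
  rw [div_le_iff₀ hpos]
  calc ∑ i ∈ I, s i ^ 2 ≤ ‖s‖ ^ 2 := by rw [norm_sq_eq_add s I]; linarith
    _ ≤ K I * ∑ i ∈ Iᶜ, s i ^ 2 := hK I (hI.trans hn₀) s hs
    _ ≤ _ := mul_le_mul_of_nonneg_right
      (Finset.single_le_sum (fun J _ => hK0 J) (Finset.mem_univ I)) hpos.le

theorem sum_le_gammaConst_mul (hURP : URP A) (hnm : n ≤ m) {n₀ : ℕ} (hn₀ : n₀ ≤ n)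
    {I : Finset (Fin m)} (hI : I.card ≤ n₀) {v : EuclideanSpace ℝ (Fin m)}
    (hv : v ∈ nullSpace A) : ∑ i ∈ I, v i ^ 2 ≤ gammaConst A n₀ * ∑ i ∈ Iᶜ, v i ^ 2 := by
  by_cases hv0 : v = 0
  · simp [hv0]
  · rw [← div_le_iff₀ (sum_compl_pos hURP hnm hv hv0 (hI.trans hn₀))]
    exact le_csSup (bddAbove_gammaConst hURP hnm hn₀) ⟨I, v, hI, hv, hv0, rfl⟩

theorem gammaConst_pos (hURP : URP A) (hnm : n < m) {n₀ : ℕ} (hn₀ : n₀ ≤ n) (h0 : 0 < n₀) :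
    0 < gammaConst A n₀ := by
  have hker : nullSpace A ≠ ⊥ :=
    LinearMap.ker_ne_bot_of_finrank_lt (by simpa using hnm)
  obtain ⟨v, hv, hv0⟩ := Submodule.exists_mem_ne_zero_of_ne_bot hker
  obtain ⟨i, hi⟩ : ∃ i, v i ≠ 0 := by
    by_contra! h; exact hv0 (by ext i; exact h i)
  have h1 : 0 < ∑ j ∈ {i}, v j ^ 2 := by rw [Finset.sum_singleton]; positivity
  have h2 := sum_le_gammaConst_mul hURP hnm.le hn₀ (I := {i}) (by simpa using! h0) hv
  exact pos_of_mul_pos_left (h1.trans_le h2) (Finset.sum_nonneg fun i _ => sq_nonneg _)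

end NullSpace

/-! ### Concavity-type behaviour of the cost on high superlevel sets. -/

section Cost

variable {n m : ℕ} {A : Matrix (Fin n) (Fin m) ℝ} {γ σ : ℝ}

/-- The gradient of the cost function. -/
def costGrad (γ σ : ℝ) (s : EuclideanSpace ℝ (Fin m)) : EuclideanSpace ℝ (Fin m) :=
  WithLp.toLp 2 fun i => splineDeriv γ (s i / σ) / σ

theorem inner_costGrad (s v : EuclideanSpace ℝ (Fin m)) :
    inner ℝ (costGrad γ σ s) v = ∑ i, splineDeriv γ (s i / σ) / σ * v i := by
  rw [PiLp.inner_apply]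
  exact Finset.sum_congr rfl fun i _ => mul_comm _ _

theorem hasGradientAt_cost (hγ : 0 < γ) (s : EuclideanSpace ℝ (Fin m)) :
    HasGradientAt (cost γ σ) (costGrad γ σ s) s := by
  rw [hasGradientAt_iff_hasFDerivAt]
  have h : HasFDerivAt (cost γ σ) (∑ i, (splineDeriv γ (s i / σ) / σ) •
      (EuclideanSpace.proj i : EuclideanSpace ℝ (Fin m) →L[ℝ] ℝ)) s := by
    refine HasFDerivAt.fun_sum fun i _ => ?_
    have h1 : HasDerivAt (fun t => spline γ (t / σ)) (splineDeriv γ (s i / σ) / σ) (s i) := by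
      have := (hasDerivAt_spline hγ (s i / σ)).comp (s i) ((hasDerivAt_id (s i)).div_const σ)
      simpa [Function.comp_def, div_eq_mul_inv] using this
    exact h1.comp_hasFDerivAt s
      (EuclideanSpace.proj i : EuclideanSpace ℝ (Fin m) →L[ℝ] ℝ).hasFDerivAt
  refine h.congr_fderiv (ContinuousLinearMap.ext fun v => ?_)
  rw [InnerProductSpace.toDual_apply_apply, inner_costGrad]
  simp

theorem norm_le_mul_norm_of_forall {a b : EuclideanSpace ℝ (Fin m)} {C : ℝ} (hC : 0 ≤ C)
    (h : ∀ i, |a i| ≤ C * |b i|) : ‖a‖ ≤ C * ‖b‖ := by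
  rw [← pow_le_pow_iff_left₀ (norm_nonneg _) (by positivity) two_ne_zero, mul_pow,
    EuclideanSpace.real_norm_sq_eq, EuclideanSpace.real_norm_sq_eq, Finset.mul_sum]
  refine Finset.sum_le_sum fun i _ => ?_
  have := pow_le_pow_left₀ (abs_nonneg _) (h i) 2
  rwa [mul_pow, sq_abs, sq_abs] at this

theorem exists_lipschitzWith_costGrad (hγ : 0 < γ) (hσ : 0 < σ) :
    ∃ K, LipschitzWith K (costGrad (m := m) γ σ) := by
  have hC : 0 ≤ (2 / (1 + γ) + 4 / γ + 4 / (γ * (1 + γ))) / σ / σ := by positivity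
  refine ⟨⟨_, hC⟩, LipschitzWith.of_dist_le_mul fun s s' => ?_⟩
  rw [dist_eq_norm, dist_eq_norm]
  refine norm_le_mul_norm_of_forall hC fun i => ?_
  have h := abs_splineDeriv_sub_le hγ (s i / σ) (s' i / σ)
  rw [← sub_div, abs_div, abs_of_pos hσ] at h
  simp only [costGrad, PiLp.sub_apply]
  rw [← sub_div, abs_div, abs_of_pos hσ]
  calc _ ≤ ((2 / (1 + γ) + 4 / γ + 4 / (γ * (1 + γ))) * (|s i - s' i| / σ)) / σ := by gcongr
    _ = (2 / (1 + γ) + 4 / γ + 4 / (γ * (1 + γ))) / σ / σ * |s i - s' i| := by ring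

theorem exists_norm_costGrad_le (hγ : 0 < γ) (hσ : 0 < σ) :
    ∃ L : NNReal, ∀ s, ‖costGrad (m := m) γ σ s‖ ≤ L := by
  have hC : 0 ≤ 2 / (1 + γ) / σ := by positivity
  refine ⟨⟨_, mul_nonneg hC (norm_nonneg (WithLp.toLp 2 fun _ => 1 : EuclideanSpace ℝ (Fin m)))⟩,
    fun s => norm_le_mul_norm_of_forall hC fun i => ?_⟩
  simp only [costGrad, abs_one, mul_one]
  rw [abs_div, abs_of_pos hσ]
  gcongr
  exact abs_splineDeriv_le hγ _

/-- The indices of the coordinates exceeding `σ`. -/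
def largeIdx (σ : ℝ) (s : EuclideanSpace ℝ (Fin m)) : Finset (Fin m) :=
  Finset.univ.filter fun i => σ < |s i|

theorem cost_le_sub_card (hγ : 0 < γ) (hσ : 0 < σ) (s : EuclideanSpace ℝ (Fin m)) :
    cost γ σ s ≤ m - (largeIdx σ s).card / (1 + γ) := by
  have h : cost γ σ s ≤ ∑ i : Fin m, (1 - if σ < |s i| then 1 / (1 + γ) else 0) := by
    refine Finset.sum_le_sum fun i _ => ?_
    split_ifs with hi
    · exact spline_le_of_one_lt hγ (by rwa [abs_div, abs_of_pos hσ, one_lt_div hσ])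
    · simpa using spline_le_one hγ _
  refine h.trans_eq ?_
  rw [Finset.sum_sub_distrib, ← Finset.sum_filter]
  simp [largeIdx, div_eq_mul_inv]

/-- This is the origin of the threshold `n₀ / (2 + 2γ)`: each point may use half of the budget `n₀`.
-/
theorem two_mul_card_largeIdx_le (hγ : 0 < γ) (hσ : 0 < σ) {n₀ : ℕ}
    {s : EuclideanSpace ℝ (Fin m)} (hs : m - n₀ / (2 + 2 * γ) ≤ cost γ σ s) :
    2 * (largeIdx σ s).card ≤ n₀ := by
  have h := hs.trans (cost_le_sub_card hγ hσ s)
  have e : (n₀ : ℝ) / (2 + 2 * γ) = (n₀ / 2) / (1 + γ) := by field_simp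
  rw [e, sub_le_sub_iff_left, div_le_div_iff_of_pos_right (by positivity)] at h
  have : (2 : ℝ) * (largeIdx σ s).card ≤ n₀ := by linarith
  exact_mod_cast this

theorem card_union_largeIdx_le (hγ : 0 < γ) (hσ : 0 < σ) {n₀ : ℕ}
    {s s' : EuclideanSpace ℝ (Fin m)} (hs : m - n₀ / (2 + 2 * γ) ≤ cost γ σ s)
    (hs' : m - n₀ / (2 + 2 * γ) ≤ cost γ σ s') :
    (largeIdx σ s ∪ largeIdx σ s').card ≤ n₀ := by
  have h1 := two_mul_card_largeIdx_le hγ hσ hs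
  have h2 := two_mul_card_largeIdx_le hγ hσ hs'
  have h3 := Finset.card_union_le (largeIdx σ s) (largeIdx σ s')
  omega

theorem abs_le_of_notMem_union {s s' : EuclideanSpace ℝ (Fin m)} {i : Fin m}
    (hi : i ∉ largeIdx σ s ∪ largeIdx σ s') : |s i| ≤ σ ∧ |s' i| ≤ σ := by
  simpa [largeIdx, not_or] using hi

/-- Two points of a high superlevel set which differ by a null vector are close. -/
theorem norm_sub_sq_le (hγ : 0 < γ) (hσ : 0 < σ) {n₀ : ℕ}
    (hnull : ∀ I : Finset (Fin m), I.card ≤ n₀ → ∀ v ∈ nullSpace A,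
      ∑ i ∈ I, v i ^ 2 ≤ γ * ∑ i ∈ Iᶜ, v i ^ 2)
    {s s' : EuclideanSpace ℝ (Fin m)} (hs : m - n₀ / (2 + 2 * γ) ≤ cost γ σ s)
    (hs' : m - n₀ / (2 + 2 * γ) ≤ cost γ σ s') (hv : s - s' ∈ nullSpace A) :
    ‖s - s'‖ ^ 2 ≤ (1 + γ) * (m * (2 * σ) ^ 2) := by
  set I := largeIdx σ s ∪ largeIdx σ s'
  have h1 := hnull I (card_union_largeIdx_le hγ hσ hs hs') _ hv
  have h2 : ∑ i ∈ Iᶜ, (s - s') i ^ 2 ≤ m * (2 * σ) ^ 2 := by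
    have h3 : ∀ i ∈ Iᶜ, (s - s') i ^ 2 ≤ (2 * σ) ^ 2 := fun i hi => by
      obtain ⟨ha, hb⟩ := abs_le_of_notMem_union (Finset.mem_compl.1 hi)
      rw [sq_le_sq, abs_of_pos (by positivity : 0 < 2 * σ), PiLp.sub_apply]
      linarith [abs_sub (s i) (s' i)]
    refine (Finset.sum_le_card_nsmul _ _ _ h3).trans ?_
    rw [nsmul_eq_mul]
    gcongr
    exact_mod_cast (Finset.card_le_univ _).trans_eq (Fintype.card_fin m)
  rw [norm_sq_eq_add _ I]
  nlinarith

/-- The gradient inequality of concave functions, for two points of a high superlevel set which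
differ by a null vector. -/
theorem cost_le_add_inner (hγ : 0 < γ) (hσ : 0 < σ) {n₀ : ℕ}
    (hnull : ∀ I : Finset (Fin m), I.card ≤ n₀ → ∀ v ∈ nullSpace A,
      ∑ i ∈ I, v i ^ 2 ≤ γ * ∑ i ∈ Iᶜ, v i ^ 2)
    {s s' : EuclideanSpace ℝ (Fin m)} (hs : m - n₀ / (2 + 2 * γ) ≤ cost γ σ s)
    (hs' : m - n₀ / (2 + 2 * γ) ≤ cost γ σ s') (hv : s' - s ∈ nullSpace A) :
    cost γ σ s' ≤ cost γ σ s + inner ℝ (costGrad γ σ s) (s' - s) := by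
  set I := largeIdx σ s ∪ largeIdx σ s'
  have h1 := hnull I (card_union_largeIdx_le hγ hσ hs hs') _ hv
  have hin : ∀ i, spline γ (s' i / σ) ≤ spline γ (s i / σ)
      + splineDeriv γ (s i / σ) / σ * (s' - s) i + (s' - s) i ^ 2 / (σ ^ 2 * (γ * (1 + γ))) := by
    intro i
    refine (spline_le hγ (s i / σ) (s' i / σ)).trans_eq ?_
    rw [PiLp.sub_apply, ← sub_div]; field_simp
  have hout : ∀ i ∈ Iᶜ, spline γ (s' i / σ) ≤ spline γ (s i / σ)
      + splineDeriv γ (s i / σ) / σ * (s' - s) i - (s' - s) i ^ 2 / (σ ^ 2 * (1 + γ)) := by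
    intro i hi
    obtain ⟨ha, hb⟩ := abs_le_of_notMem_union (Finset.mem_compl.1 hi)
    have hs1 : ∀ x : ℝ, |x| ≤ σ → |x / σ| ≤ 1 := fun x hx => by
      rwa [abs_div, abs_of_pos hσ, div_le_one hσ]
    refine (spline_eq_of_abs_le_one hγ (hs1 _ ha) (hs1 _ hb)).le.trans_eq ?_
    rw [PiLp.sub_apply, ← sub_div]; field_simp
  rw [inner_costGrad]
  unfold cost
  rw [← Finset.sum_add_sum_compl I fun i => spline γ (s' i / σ),
    ← Finset.sum_add_sum_compl I fun i => spline γ (s i / σ),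
    ← Finset.sum_add_sum_compl I fun i => splineDeriv γ (s i / σ) / σ * (s' - s) i]
  have h2 := Finset.sum_le_sum fun i (_ : i ∈ I) => hin i
  have h3 := Finset.sum_le_sum hout
  rw [Finset.sum_add_distrib, Finset.sum_add_distrib, ← Finset.sum_div] at h2
  rw [Finset.sum_sub_distrib, Finset.sum_add_distrib, ← Finset.sum_div] at h3
  -- The two curvatures differ by exactly the factor `γ` of the null space inequality.
  have h4 : (∑ i ∈ I, (s' - s) i ^ 2) / (σ ^ 2 * (γ * (1 + γ)))
      ≤ (∑ i ∈ Iᶜ, (s' - s) i ^ 2) / (σ ^ 2 * (1 + γ)) := by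
    rw [div_le_div_iff₀ (by positivity) (by positivity)]
    have : 0 ≤ σ ^ 2 * (1 + γ) := by positivity
    nlinarith [mul_le_mul_of_nonneg_right h1 this]
  linarith

/-- The restricted cost attains its maximum if it takes a high enough value. -/
theorem exists_isMaxOn_cost (hγ : 0 < γ) (hσ : 0 < σ) {n₀ : ℕ}
    (hnull : ∀ I : Finset (Fin m), I.card ≤ n₀ → ∀ v ∈ nullSpace A,
      ∑ i ∈ I, v i ^ 2 ≤ γ * ∑ i ∈ Iᶜ, v i ^ 2)
    {p : EuclideanSpace ℝ (Fin m)} (hp : m - n₀ / (2 + 2 * γ) ≤ cost γ σ p) :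
    ∃ q, q - p ∈ nullSpace A ∧ ∀ s, s - p ∈ nullSpace A → cost γ σ s ≤ cost γ σ q := by
  have hc : Continuous (cost (m := m) γ σ) :=
    continuous_iff_continuousAt.2 fun s => (hasGradientAt_cost hγ s).continuousAt
  -- Points below the level of `p` are irrelevant, and the rest are within a bounded distance of
  -- `p`.
  let K : Set (EuclideanSpace ℝ (Fin m)) := {s | s - p ∈ nullSpace A ∧ cost γ σ p ≤ cost γ σ s}
  have hK1 : IsClosed ((fun s => s - p) ⁻¹' (nullSpace A : Set (EuclideanSpace ℝ (Fin m)))) :=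
    (Submodule.closed_of_finiteDimensional (nullSpace A)).preimage (continuous_sub_right p)
  have hK : IsClosed K := hK1.inter (isClosed_le continuous_const hc)
  have hKb : K ⊆ Metric.closedBall p √((1 + γ) * (m * (2 * σ) ^ 2)) := fun s hs => by
    rw [mem_closedBall_iff_norm]
    exact Real.le_sqrt_of_sq_le (norm_sub_sq_le hγ hσ hnull (hp.trans hs.2) hp hs.1)
  have hKc : IsCompact K := (isCompact_closedBall p _).of_isClosed_subset hK hKb
  have hpK : p ∈ K := ⟨by simp, le_rfl⟩
  obtain ⟨q, hq, hmax⟩ := hKc.exists_isMaxOn ⟨p, hpK⟩ hc.continuousOn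
  refine ⟨q, hq.1, fun s hs => ?_⟩
  by_cases h : cost γ σ p ≤ cost γ σ s
  · exact hmax ⟨hs, h⟩
  · exact (not_le.1 h).le.trans hq.2

theorem restrictedGradient_cost (hγ : 0 < γ) (s : EuclideanSpace ℝ (Fin m)) :
    restrictedGradient A (cost γ σ) s = (nullSpace A).starProjection (costGrad γ σ s) := by
  rw [restrictedGradient, (hasGradientAt_cost hγ s).gradient]

theorem exists_isSteepestAscent (hγ : 0 < γ) (hσ : 0 < σ) (p : EuclideanSpace ℝ (Fin m)) :
    ∃ α, IsSteepestAscent A (cost γ σ) p α := by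
  obtain ⟨K, hK⟩ := exists_lipschitzWith_costGrad (m := m) hγ hσ
  obtain ⟨L, hL⟩ := exists_norm_costGrad_le (m := m) hγ hσ
  obtain ⟨α, h0, hα⟩ := exists_integralCurve_Ici
    ((nullSpace A).lipschitzWith_starProjection.comp hK) (L := L)
    (fun s => ((nullSpace A).norm_starProjection_apply_le _).trans (hL s)) p
  refine ⟨α, h0, fun t ht => ?_⟩
  rw [restrictedGradient_cost hγ]
  exact hα t ht

theorem mem_solutionSet_iff {x : EuclideanSpace ℝ (Fin n)} {p s : EuclideanSpace ℝ (Fin m)}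
    (hp : p ∈ solutionSet A x) : s ∈ solutionSet A x ↔ s - p ∈ nullSpace A := by
  have hp' : mulMap A p = x := hp
  rw [nullSpace, LinearMap.mem_ker, map_sub, sub_eq_zero, hp']
  rfl

/-- A steepest ascent trajectory which starts at a point of high enough cost converges to a global
maximizer of the restricted cost. -/
theorem IsSteepestAscent.exists_tendsto (hγ : 0 < γ) (hσ : 0 < σ) {n₀ : ℕ}
    (hnull : ∀ I : Finset (Fin m), I.card ≤ n₀ → ∀ v ∈ nullSpace A,
      ∑ i ∈ I, v i ^ 2 ≤ γ * ∑ i ∈ Iᶜ, v i ^ 2)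
    {x : EuclideanSpace ℝ (Fin n)} {p : EuclideanSpace ℝ (Fin m)} (hpx : p ∈ solutionSet A x)
    (hp : m - n₀ / (2 + 2 * γ) ≤ cost γ σ p) {α : ℝ → EuclideanSpace ℝ (Fin m)}
    (hα : IsSteepestAscent A (cost γ σ) p α) :
    ∃ q, Filter.Tendsto α Filter.atTop (nhds q) ∧ q ∈ solutionSet A x ∧
      IsMaxOn (cost γ σ) (solutionSet A x) q := by
  obtain ⟨rfl, hα⟩ := hα
  obtain ⟨r, hr, hmax⟩ := exists_isMaxOn_cost hγ hσ hnull hp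
  obtain ⟨q, hq, hqW, hqmax⟩ := exists_tendsto_of_gradientFlow (nullSpace A)
    (hasGradientAt_cost hγ) (fun t ht => by rw [← restrictedGradient_cost hγ]; exact hα t ht)
    (fun s s' hs hs' h h' => cost_le_add_inner hγ hσ hnull (hp.trans h) (hp.trans h')
      (by simpa using (nullSpace A).sub_mem hs' hs)) hr hmax
  exact ⟨q, hq, (mem_solutionSet_iff hpx).2 hqW,
    fun s hs => hqmax s ((mem_solutionSet_iff hpx).1 hs)⟩

end Cost

/-! ### Cost estimates for sparse, perturbed, rescaled and minimum norm points. -/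

section Bounds

variable {n m : ℕ} {A : Matrix (Fin n) (Fin m) ℝ} {γ σ : ℝ}

theorem pinvSol_eq (hA : A * Aᵀ = 1) (y : EuclideanSpace ℝ (Fin n)) :
    pinvSol A y = WithLp.toLp 2 (Aᵀ *ᵥ y.ofLp) := by
  rw [pinvSol, hA, inv_one, Matrix.mul_one, Matrix.toLpLin_apply]

theorem mulMap_pinvSol (hA : A * Aᵀ = 1) (y : EuclideanSpace ℝ (Fin n)) :
    mulMap A (pinvSol A y) = y := by
  rw [pinvSol_eq hA, mulMap, Matrix.toLpLin_apply, Matrix.mulVec_mulVec, hA, Matrix.one_mulVec]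

theorem norm_pinvSol (hA : A * Aᵀ = 1) (y : EuclideanSpace ℝ (Fin n)) :
    ‖pinvSol A y‖ = ‖y‖ := by
  have h : ∀ {l : ℕ} (s : EuclideanSpace ℝ (Fin l)), ‖s‖ ^ 2 = s.ofLp ⬝ᵥ s.ofLp := fun s => by
    rw [EuclideanSpace.real_norm_sq_eq]
    exact Finset.sum_congr rfl fun i _ => sq _
  rw [← pow_left_inj₀ (norm_nonneg _) (norm_nonneg _) two_ne_zero, h, h, pinvSol_eq hA,
    Matrix.dotProduct_mulVec, Matrix.vecMul_transpose, Matrix.mulVec_mulVec, hA, Matrix.one_mulVec]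

/-- The estimates come out with `ε` alone; this inserts the factor `‖A‖₂`. -/
theorem one_le_specNorm (hA : A * Aᵀ = 1) (hn : 0 < n) : 1 ≤ specNorm A := by
  let y : EuclideanSpace ℝ (Fin n) := EuclideanSpace.single ⟨0, hn⟩ 1
  have hy : ‖y‖ = 1 := by simp [y]
  have h := (LinearMap.toContinuousLinearMap (mulMap A)).le_opNorm (pinvSol A y)
  rw [norm_pinvSol hA, hy, mul_one, LinearMap.coe_toContinuousLinearMap', mulMap_pinvSol hA, hy] at h
  exact h

theorem sub_l0_le_cost (hγ : 0 < γ) (s : EuclideanSpace ℝ (Fin m)) :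
    (m : ℝ) - l0 s ≤ cost γ σ s := by
  have h : ∑ i : Fin m, (1 - if s i ≠ 0 then (1 : ℝ) else 0) ≤ cost γ σ s := by
    refine Finset.sum_le_sum fun i _ => ?_
    split_ifs with hi
    · simpa using spline_nonneg hγ _
    · rw [not_not.1 hi]; simp [spline_zero]
  refine le_trans (le_of_eq ?_) h
  rw [Finset.sum_sub_distrib, ← Finset.sum_filter]
  simp [l0, hammingNorm]

theorem sum_abs_le (v : EuclideanSpace ℝ (Fin m)) : ∑ i, |v i| ≤ √m * ‖v‖ := by
  refine le_of_sq_le_sq ?_ (by positivity)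
  rw [mul_pow, Real.sq_sqrt (Nat.cast_nonneg m), EuclideanSpace.real_norm_sq_eq]
  have := sq_sum_le_card_mul_sum_sq (s := Finset.univ) (f := fun i => |v i|)
  simpa using this

theorem cost_sub_le (hγ : 0 < γ) (hσ : 0 < σ) (s s' : EuclideanSpace ℝ (Fin m)) :
    cost γ σ s - cost γ σ s' ≤ 2 / (1 + γ) / σ * (√m * ‖s - s'‖) := by
  unfold cost
  rw [← Finset.sum_sub_distrib]
  calc ∑ i, (spline γ (s i / σ) - spline γ (s' i / σ))
      ≤ ∑ i, 2 / (1 + γ) / σ * |(s - s') i| := by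
        refine Finset.sum_le_sum fun i _ => ?_
        refine ((le_abs_self _).trans (abs_spline_sub_le hγ _ _)).trans_eq ?_
        rw [← sub_div, abs_div, abs_of_pos hσ, PiLp.sub_apply]; ring
    _ = 2 / (1 + γ) / σ * ∑ i, |(s - s') i| := by rw [Finset.mul_sum]
    _ ≤ _ := by gcongr; exact sum_abs_le _

theorem cost_le_cost_mul_add (hγ : 0 < γ) {c : ℝ} (hc : 0 < c) (hc1 : c ≤ 1)
    (s : EuclideanSpace ℝ (Fin m)) :
    cost γ σ s ≤ cost γ (σ * c) s + m * (2 * (1 / c - 1)) := by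
  have h : cost γ σ s - cost γ (σ * c) s ≤ ∑ _i : Fin m, 2 * (1 / c - 1) := by
    unfold cost
    rw [← Finset.sum_sub_distrib]
    refine Finset.sum_le_sum fun i _ => ?_
    rw [← div_div]
    exact spline_sub_spline_div_le hγ hc hc1 _
  simp only [Finset.sum_const, Finset.card_univ, Fintype.card_fin, nsmul_eq_mul] at h
  linarith

theorem sub_norm_sq_le_cost (hγ : 0 < γ) (s : EuclideanSpace ℝ (Fin m)) :
    m - ‖s‖ ^ 2 / σ ^ 2 / (1 + γ) ≤ cost γ σ s := by
  have h : ∑ i, (1 - (s i / σ) ^ 2 / (1 + γ)) ≤ cost γ σ s :=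
    Finset.sum_le_sum fun i _ => one_sub_sq_le_spline hγ _
  refine le_trans (le_of_eq ?_) h
  simp_rw [Finset.sum_sub_distrib, div_pow, ← Finset.sum_div,
    ← EuclideanSpace.real_norm_sq_eq]
  simp

/-- The cost of the minimum norm solution at the initial scale. -/
theorem sub_le_cost_pinvSol (hγ : 0 < γ) {κ : ℝ} (hκ : 0 < κ) {s : EuclideanSpace ℝ (Fin m)}
    (hσ : σ = ‖s‖ / √(κ * (1 + γ))) (hσ0 : 0 < σ) : m - κ ≤ cost γ σ s := by
  refine le_trans (le_of_eq ?_) (sub_norm_sq_le_cost hγ s)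
  have hp : 0 < κ * (1 + γ) := by positivity
  have hs : ‖s‖ = σ * √(κ * (1 + γ)) := by
    rw [hσ, div_mul_cancel₀ _ (Real.sqrt_pos.2 hp).ne']
  rw [hs, mul_pow, Real.sq_sqrt hp.le]
  field_simp

end Bounds

end

end SL0

/-! ### The annealing schedule and the error bound. -/

theorem mainTheorem6 {n m n₀ : ℕ} (hnm : n < m) (hn₀ : n₀ ≤ n)
    (A : Matrix (Fin n) (Fin m) ℝ) (hA : A * A.transpose = 1) (hURP : SL0.URP A)
    (γ : ℝ) (hγ : γ = SL0.gammaConst A n₀)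
    (x : EuclideanSpace ℝ (Fin n)) (ε : ℝ) (hε : 0 < ε)
    (s₀ : EuclideanSpace ℝ (Fin m)) (hs₀ : ‖SL0.mulMap A s₀ - x‖ < ε)
    (k : ℕ) (hk : k = SL0.l0 s₀) (hk_lt : (k : ℝ) < n₀ / (2 + 2 * γ))
    (k' : ℝ) (hkk' : (k : ℝ) < k') (hk' : k' < n₀ / (2 + 2 * γ))
    (c : ℝ) (hc : c = 2 * m / (2 * m + n₀ / (2 + 2 * γ) - k'))
    (σ : ℕ → ℝ) (hσ_one : σ 1 = ‖SL0.pinvSol A x‖ / Real.sqrt (k' * (1 + γ)))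
    (hσ : ∀ j, 1 ≤ j → σ j = σ 1 * c ^ (j - 1))
    (J : ℕ) (hJ : 1 ≤ J)
    (hσJ : σ J ≥ 2 * Real.sqrt m * SL0.specNorm A * ε / ((1 + γ) * (k' - k)))
    (hσJ_succ : 2 * Real.sqrt m * SL0.specNorm A * ε / ((1 + γ) * (k' - k)) > σ (J + 1)) :
    c < 1 ∧
    (∃ s : ℕ → EuclideanSpace ℝ (Fin m), SL0.IsAsymptoticRun A x γ σ J s) ∧
    ∀ s : ℕ → EuclideanSpace ℝ (Fin m), SL0.IsAsymptoticRun A x γ σ J s →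
      (∀ j, 2 ≤ j → j ≤ J → s j ∈ SL0.solutionSet A x ∧
        IsMaxOn (SL0.cost γ (σ j)) (SL0.solutionSet A x) (s j)) ∧
      ‖s J - s₀‖ ≤
        (4 * m / (c * (k' - k) * Real.sqrt (γ + 1)) + 1) * SL0.specNorm A * ε := by
  have hn₀0 : 0 < n₀ := by
    rcases Nat.eq_zero_or_pos n₀ with h | h
    · rw [h, Nat.cast_zero, zero_div] at hk_lt
      exact absurd hk_lt (not_lt.2 k.cast_nonneg)
    · exact h
  have hγ0 : 0 < γ := hγ ▸ SL0.gammaConst_pos hURP hnm hn₀ hn₀0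
  have hnull : ∀ I : Finset (Fin m), I.card ≤ n₀ → ∀ v ∈ SL0.nullSpace A,
      ∑ i ∈ I, v i ^ 2 ≤ γ * ∑ i ∈ Iᶜ, v i ^ 2 := fun I hI v hv =>
    hγ ▸ SL0.sum_le_gammaConst_mul hURP hnm.le hn₀ hI hv
  have hm : (0 : ℝ) < m := by exact_mod_cast (Nat.zero_le n).trans_lt hnm
  have hN : 1 ≤ SL0.specNorm A := SL0.one_le_specNorm hA (hn₀0.trans_le hn₀)
  have hk'0 : 0 < k' := k.cast_nonneg.trans_lt hkk'
  have hkk : 0 < k' - k := sub_pos.2 hkk'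
  set ρ : ℝ := n₀ / (2 + 2 * γ) with hρ
  have hD : 0 < 2 * (m : ℝ) + ρ - k' := by linarith
  have hc0 : 0 < c := by rw [hc]; positivity
  have hc1 : c < 1 := by rw [hc, div_lt_one hD]; linarith
  -- The ratio `c` is chosen so that the loss bound of one rescaling is exactly `ρ - k'`.
  have hcinv : (m : ℝ) * (2 * (1 / c - 1)) = ρ - k' := by
    rw [hc, one_div_div]; field_simp; ring
  set T : ℝ := 2 * Real.sqrt m * SL0.specNorm A * ε / ((1 + γ) * (k' - k)) with hT
  have hT0 : 0 < T := by positivity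
  have hσ1 : 0 < σ 1 := by
    have h := hT0.trans_le hσJ
    rw [hσ J hJ] at h
    exact pos_of_mul_pos_left h (by positivity)
  have hσpos : ∀ j, 1 ≤ j → 0 < σ j := fun j hj => by rw [hσ j hj]; positivity
  have hσT : ∀ j, 1 ≤ j → j ≤ J → T ≤ σ j := fun j hj hjJ => by
    refine le_trans hσJ ?_
    rw [hσ j hj, hσ J hJ]
    exact mul_le_mul_of_nonneg_left (pow_le_pow_of_le_one hc0.le hc1.le (by omega)) hσ1.le
  have hσsucc : ∀ j, 1 ≤ j → σ (j + 1) = σ j * c := fun j hj => by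
    obtain ⟨i, rfl⟩ := Nat.exists_eq_add_of_le' hj
    rw [hσ _ hj, hσ _ (by omega), mul_assoc, ← pow_succ]; rfl
  -- the projection of the sparse vector to the solution set
  obtain ⟨p, hpx, hps⟩ : ∃ p ∈ SL0.solutionSet A x, ‖p - s₀‖ ≤ ε := by
    -- Since `Aᵀ` is an isometry, the correction has the norm of the residual.
    refine ⟨s₀ - SL0.pinvSol A (SL0.mulMap A s₀ - x), ?_, ?_⟩
    · change SL0.mulMap A _ = x
      rw [map_sub, SL0.mulMap_pinvSol hA]; abel
    · rw [sub_sub_cancel_left, norm_neg, SL0.norm_pinvSol hA]; exact hs₀.le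
  have hpcost : ∀ j, 1 ≤ j → j ≤ J → m - k' ≤ SL0.cost γ (σ j) p := fun j hj hjJ => by
    have h1 := SL0.sub_l0_le_cost (σ := σ j) hγ0 s₀
    rw [← hk] at h1
    have h2 := SL0.cost_sub_le hγ0 (hσpos j hj) s₀ p
    -- The threshold `T` is the scale at which the Lipschitz loss, with `‖A‖₂ ε` as the distance,
    -- equals `k' - k`.
    have h3 : 2 / (1 + γ) / σ j * (√m * ‖s₀ - p‖) ≤ k' - k := by
      rw [norm_sub_rev]
      have h4 : 2 / (1 + γ) * (√m * ‖p - s₀‖) ≤ (k' - k) * T := by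
        have e : (k' - k) * T = 2 / (1 + γ) * (√m * (SL0.specNorm A * ε)) := by
          rw [hT]; field_simp
        rw [e]
        gcongr
        exact hps.trans (le_mul_of_one_le_left hε.le hN)
      rw [div_mul_eq_mul_div, div_le_iff₀ (hσpos j hj)]
      exact h4.trans (mul_le_mul_of_nonneg_left (hσT j hj hjJ) hkk.le)
    linarith
  have hinit : SL0.pinvSol A x ∈ SL0.solutionSet A x ∧
      m - k' ≤ SL0.cost γ (σ 1) (SL0.pinvSol A x) :=
    ⟨SL0.mulMap_pinvSol hA x, SL0.sub_le_cost_pinvSol hγ0 hk'0 hσ_one hσ1⟩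
  -- one step of the algorithm
  have hstep : ∀ j, 1 ≤ j → j + 1 ≤ J → ∀ s, s ∈ SL0.solutionSet A x →
      m - k' ≤ SL0.cost γ (σ j) s → ∀ α, SL0.IsSteepestAscent A (SL0.cost γ (σ (j + 1))) s α →
      ∃ q, Filter.Tendsto α Filter.atTop (nhds q) ∧ q ∈ SL0.solutionSet A x ∧
        IsMaxOn (SL0.cost γ (σ (j + 1))) (SL0.solutionSet A x) q ∧
        m - k' ≤ SL0.cost γ (σ (j + 1)) q := by
    intro j hj hjJ s hs hcost α hα
    have h1 := SL0.cost_le_cost_mul_add (σ := σ j) hγ0 hc0 hc1.le s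
    rw [hcinv, ← hσsucc j hj] at h1
    obtain ⟨q, hq, hqx, hmax⟩ := hα.exists_tendsto hγ0 (hσpos _ (by omega)) hnull hs
      (by linarith)
    -- The maximizer does at least as well as `p`, which restores the level `m - k'`.
    exact ⟨q, hq, hqx, hmax, (hpcost _ (by omega) hjJ).trans (hmax hpx)⟩
  refine ⟨hc1, ?_, fun s hs => ?_⟩
  · have hnext : ∀ (j : ℕ) (s : EuclideanSpace ℝ (Fin m)), ∃ q, 1 ≤ j → j + 1 ≤ J →
        s ∈ SL0.solutionSet A x → m - k' ≤ SL0.cost γ (σ j) s →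
        (q ∈ SL0.solutionSet A x ∧ m - k' ≤ SL0.cost γ (σ (j + 1)) q) ∧
        ∃ α, SL0.IsSteepestAscent A (SL0.cost γ (σ (j + 1))) s α ∧
          Filter.Tendsto α Filter.atTop (nhds q) := by
      intro j s
      by_cases h : 1 ≤ j ∧ j + 1 ≤ J ∧ s ∈ SL0.solutionSet A x ∧ m - k' ≤ SL0.cost γ (σ j) s
      · obtain ⟨h1, h2, h3, h4⟩ := h
        obtain ⟨α, hα⟩ := SL0.exists_isSteepestAscent (A := A) hγ0 (hσpos (j + 1) (by omega)) s
        obtain ⟨q, hq, hqx, -, hcost⟩ := hstep j h1 h2 s h3 h4 α hα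
        exact ⟨q, fun _ _ _ _ => ⟨⟨hqx, hcost⟩, α, hα, hq⟩⟩
      · exact ⟨0, fun h1 h2 h3 h4 => absurd ⟨h1, h2, h3, h4⟩ h⟩
    choose next hnext using hnext
    -- The index is shifted: `u i` is iterate `i + 1`.
    let u : ℕ → EuclideanSpace ℝ (Fin m) :=
      Nat.rec (SL0.pinvSol A x) fun i s => next (i + 1) s
    have hu : ∀ i, i + 1 ≤ J →
        u i ∈ SL0.solutionSet A x ∧ m - k' ≤ SL0.cost γ (σ (i + 1)) (u i) := by
      intro i
      induction i with
      | zero => exact fun _ => hinit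
      | succ i ih =>
        intro hi
        obtain ⟨h1, h2⟩ := ih (by omega)
        exact (hnext (i + 1) (u i) (by omega) hi h1 h2).1
    refine ⟨fun j => u (j - 1), rfl, fun j hj hjJ => ?_⟩
    obtain ⟨i, rfl⟩ := Nat.exists_eq_add_of_le' hj
    obtain ⟨h1, h2⟩ := hu i (by omega)
    exact (hnext (i + 1) (u i) (by omega) hjJ h1 h2).2
  · obtain ⟨hs1, hsj⟩ := hs
    have hrun : ∀ i, i + 1 ≤ J →
        (s (i + 1) ∈ SL0.solutionSet A x ∧ m - k' ≤ SL0.cost γ (σ (i + 1)) (s (i + 1))) ∧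
        (1 ≤ i → IsMaxOn (SL0.cost γ (σ (i + 1))) (SL0.solutionSet A x) (s (i + 1))) := by
      intro i
      induction i with
      | zero => exact fun _ => ⟨by rw [zero_add, hs1]; exact hinit, fun h => absurd h (by omega)⟩
      | succ i ih =>
        intro hi
        obtain ⟨⟨h1, h2⟩, -⟩ := ih (by omega)
        obtain ⟨α, hα, hlim⟩ := hsj (i + 1 + 1) (by omega) hi
        obtain ⟨q, hq, hqx, hmax, hcost⟩ := hstep (i + 1) (by omega) hi _ h1 h2 α hα
        -- `hstep` holds for any trajectory, so uniqueness of trajectories is not needed, only that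
        -- of limits.
        obtain rfl := tendsto_nhds_unique hq hlim
        exact ⟨⟨hqx, hcost⟩, fun _ => hmax⟩
    refine ⟨fun j hj hjJ => ?_, ?_⟩
    · obtain ⟨i, rfl⟩ := Nat.exists_eq_add_of_le' (le_trans one_le_two hj)
      obtain ⟨⟨h1, -⟩, h2⟩ := hrun i hjJ
      exact ⟨h1, h2 (by omega)⟩
    · obtain ⟨h1, h2⟩ : s J ∈ SL0.solutionSet A x ∧ m - k' ≤ SL0.cost γ (σ J) (s J) := by
        obtain ⟨i, rfl⟩ := Nat.exists_eq_add_of_le' hJ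
        exact (hrun i le_rfl).1
      have hdist := SL0.norm_sub_sq_le (n₀ := n₀) hγ0 (hσpos J hJ) hnull
        (s := s J) (s' := p) (by linarith) (by linarith [hpcost J hJ le_rfl])
        ((SL0.mem_solutionSet_iff hpx).1 h1)
      -- The next scale `σ J * c` is already below `T`; this puts the factor `1 / c` in the
      -- constant.
      have hσJ' : σ J ≤ T / c := by
        rw [le_div_iff₀ hc0, ← hσsucc J hJ]; exact hσJ_succ.le
      have hsq : √(γ + 1) ^ 2 = 1 + γ := by rw [Real.sq_sqrt (by linarith)]; ring
      have hsm : √(m : ℝ) ^ 2 = m := Real.sq_sqrt hm.le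
      have hg0 : 0 < √(γ + 1) := Real.sqrt_pos.2 (by linarith)
      have hdist' : ‖s J - p‖ ≤ √(γ + 1) * √m * (2 * σ J) := by
        have := hσpos J hJ
        rw [← pow_le_pow_iff_left₀ (norm_nonneg _) (by positivity) two_ne_zero, mul_pow, mul_pow,
          hsq, hsm, mul_assoc]
        exact hdist
      have hfinal : ‖s J - p‖ ≤ 4 * m / (c * (k' - k) * √(γ + 1)) * SL0.specNorm A * ε := by
        refine hdist'.trans ?_
        calc √(γ + 1) * √m * (2 * σ J) ≤ √(γ + 1) * √m * (2 * (T / c)) := by gcongr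
          _ = 4 * √m ^ 2 * √(γ + 1) * SL0.specNorm A * ε / (c * (k' - k) * (1 + γ)) := by
            rw [hT]; field_simp; ring
          _ = _ := by rw [hsm, ← hsq]; field_simp
      calc ‖s J - s₀‖ ≤ ‖s J - p‖ + ‖p - s₀‖ := norm_sub_le_norm_sub_add_norm_sub _ _ _
        _ ≤ 4 * m / (c * (k' - k) * √(γ + 1)) * SL0.specNorm A * ε + SL0.specNorm A * ε :=
          add_le_add hfinal (hps.trans (le_mul_of_one_le_left hε.le hN))
        _ = _ := by ring
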